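/- **Setting (Markovian change-point model).** There are finitely many treatments $1,\dots,K$. Responses take values in a measurable space $\mathbb Y$ with a $\sigma$-finite measure $\mu$; for each treatment $x$ let $f_x$ and $g_x$ be probability densities with respect to $\mu$, and let $p_x\in[0,1]$. A treatment assignment rule $\mathcal X=\{X_t,t\ge1\}$ chooses each treatment $X_t\in\{1,\dots,K\}$ as a measurable function of the responses $Y_1,\dots,Y_{t-1}$. Let $\pi\in[0,1]$. Under ${\sf P}_\pi$ and the rule $\mathcal X$, the latent state $L_t\in\{0,1\}$ starts with ${\sf P}_\pi(L_0=1)=\pi$. At each time $t\ge1$, given the whole past, $L_t=1$ if $L_{t-1}=1$, while if $L_{t-1}=0$ then $L_t=1$ with probability $p_{X_t}$; then, given the past and $L_t$, the response $Y_t$ has density $f_{X_t}$ if $L_t=0$ and $g_{X_t}$ if $L_t=1$. Let $\Theta_{\mathcal X}=\inf\{t\ge0:L_t=1\}$, let $\mathcal F_t=\sigma(Y_1,\dots,Y_t)$ (with $\mathcal F_0$ trivial), and let $$\widehat\Gamma_t(\mathcal X)={\sf P}_\pi(L_t=1\mid\mathcal F_t),\qquad \Gamma_t(\mathcal X)=\frac{{\sf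 P}_\pi(L_t=1\mid\mathcal F_t)}{{\sf P}_\pi(L_t=0\mid\mathcal F_t)}\in[0,\infty]$$ be the posterior probability and the posterior odds that the change has occurred by time $t$. **Optimal cost.** Let $c>0$ be the cost per observation, and let a false alarm have cost $1$. For $\pi\in[0,1]$ put $$J_c^*(\pi)=\inf_{(T,\mathcal X)}\bigl(c\,{\sf E}_\pi[T]+{\sf P}_\pi(T<\Theta_{\mathcal X})\bigr),$$ the infimum being over all assignment rules $\mathcal X$ and all $\{\mathcal F_t\}$-stopping times $T$ with values in $\{0,1,\dots,\infty\}$. **Dynamic-programming procedure.** For $z\in[0,1]$, a treatment $x$ and $y\in\mathbb Y$ put $$\phi(y;z,x)=(z+p_x(1-z))g_x(y)+(1-p_x)(1-z)f_x(y),\qquad \psi(z,x,y)=\frac{(z+p_x(1-z))g_x(y)}{\phi(y;z,x)}.$$ Let $\mathcal X_c^*=\{X^*_{t,c},t\ge1\}$ be any assignment rule such that, ${\sf P}_\pi$-almost surely, $$X^*_{t,c}\in\arg\min_{x}\int_{\mathbb Y} J_c^*(\psi(\widehat\Gamma_{t-1},x,y))\,\phi(y;\widehat\Gamma_{t-1},x)\,\mu(dy)\qquad\text{for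 all }t\ge1,$$ where $\widehat\Gamma_{t-1}=\widehat\Gamma_{t-1}(\mathcal X_c^*)$, and let $T_c^*=\inf\{t\ge0:1-\widehat\Gamma_t(\mathcal X_c^*)\le J_c^*(\widehat\Gamma_t(\mathcal X_c^*))\}$. Throughout, $\inf\emptyset=\infty$. **Theorem 1.** For every $c>0$ there is a constant $b_c\in[0,1]$, depending only on $c$ and on the model $(\mu,(f_x),(g_x),(p_x))$, such that for every prior $\pi\in[0,1]$ and every rule $\mathcal X_c^*$ as above, ${\sf P}_\pi$-almost surely, $$T_c^*=\inf\{t\ge0:\widehat\Gamma_t(\mathcal X_c^*)\ge b_c\}=\inf\{t\ge0:\Gamma_t(\mathcal X_c^*)\ge b_c/(1-b_c)\},$$ where $b_c/(1-b_c)=\infty$ if $b_c=1$. -/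

import Mathlib

open MeasureTheory ProbabilityTheory Filter

namespace ChangePoint

universe u

/-- The data of the Markovian change-point model with treatments `Fin K` and responses in `𝕐`:
densities `f x` (before the change) and `g x` (after the change) of the response to treatment `x`
with respect to the σ-finite measure `μ`, and the probability `p x` that the change happens at a
time at which treatment `x` is assigned, given that it has not happened before. -/
structure Model (K : ℕ) (𝕐 : Type u) [MeasurableSpace 𝕐] where
  μ : Measure 𝕐
  sigmaFinite : SigmaFinite μ
  f : Fin K → 𝕐 → ℝ
  g : Fin K → 𝕐 → ℝ
  measurable_f : ∀ x, Measurable (f x)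
  measurable_g : ∀ x, Measurable (g x)
  f_nonneg : ∀ x y, 0 ≤ f x y
  g_nonneg : ∀ x y, 0 ≤ g x y
  lintegral_f : ∀ x, ∫⁻ y, ENNReal.ofReal (f x y) ∂μ = 1
  lintegral_g : ∀ x, ∫⁻ y, ENNReal.ofReal (g x y) ∂μ = 1
  p : Fin K → ℝ
  p_mem : ∀ x, p x ∈ Set.Icc (0 : ℝ) 1

/-- A treatment assignment rule: the treatment `X_{t+1}` is a measurable function of the
responses `(Y_1, …, Y_t)`, given here as a function on `Fin t`. -/
structure AssignmentRule (K : ℕ) (𝕐 : Type u) [MeasurableSpace 𝕐] where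
  toFun : (t : ℕ) → (Fin t → 𝕐) → Fin K
  measurable_toFun : ∀ t, Measurable (toFun t)

/-- What is observed at time `t`: nothing at time `0`, a response at each later time. -/
def Obs (𝕐 : Type u) : ℕ → Type u
  | 0 => PUnit
  | _ + 1 => 𝕐

instance instMeasurableSpaceObs (𝕐 : Type u) [MeasurableSpace 𝕐] :
    (t : ℕ) → MeasurableSpace (Obs 𝕐 t)
  | 0 => inferInstanceAs (MeasurableSpace PUnit)
  | _ + 1 => inferInstanceAs (MeasurableSpace 𝕐)

/-- The state of the world at time `t`: the latent state (`true` is `1`, after the change) and the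
observation. -/
abbrev State (𝕐 : Type u) (t : ℕ) : Type u := Bool × Obs 𝕐 t

/-- The canonical space of the trajectories `(L_0), (L_1, Y_1), (L_2, Y_2), …`. -/
abbrev Traj (𝕐 : Type u) : Type u := (t : ℕ) → State 𝕐 t

/-- The latent state `L_t`. -/
def latent {𝕐 : Type u} (t : ℕ) (ω : Traj 𝕐) : Bool := (ω t).1

/-- The response `Y_{t+1}`. -/
def response {𝕐 : Type u} (t : ℕ) (ω : Traj 𝕐) : 𝕐 := (ω (t + 1)).2

/-- The treatment `X_{t+1}` that the rule assigns along a trajectory. -/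
def AssignmentRule.treatment {K : ℕ} {𝕐 : Type u} [MeasurableSpace 𝕐]
    (X : AssignmentRule K 𝕐) (t : ℕ) (ω : Traj 𝕐) : Fin K :=
  X.toFun t (fun i => response i ω)

/-- The filtration generated by the responses: `F_t = σ(Y_1, …, Y_t)`, and `F_0` is trivial. -/
def obsFiltration (𝕐 : Type u) [MeasurableSpace 𝕐] :
    Filtration ℕ (inferInstance : MeasurableSpace (Traj 𝕐)) where
  seq t := ⨆ i : Fin t, MeasurableSpace.comap (response (i : ℕ)) inferInstance
  mono' _ t h := iSup_le fun i =>
    le_iSup (fun j : Fin t => MeasurableSpace.comap (response (𝕐 := 𝕐) (j : ℕ)) inferInstance)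
      ⟨i, i.2.trans_le h⟩
  le' _ := iSup_le fun i =>
    Measurable.comap_le (measurable_snd.comp (measurable_pi_apply ((i : ℕ) + 1)))

/-- The Bernoulli law on `Bool` with probability `q` of `true`. -/
noncomputable def bern (q : ℝ) : Measure Bool :=
  ENNReal.ofReal q • Measure.dirac true + ENNReal.ofReal (1 - q) • Measure.dirac false

namespace Model

variable {K : ℕ} {𝕐 : Type u} [MeasurableSpace 𝕐] (M : Model K 𝕐)

/-- The law of a response to treatment `x` when the current latent state is `ℓ`. -/
noncomputable def respLaw (x : Fin K) (ℓ : Bool) : Measure 𝕐 :=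
  M.μ.withDensity (fun y => ENNReal.ofReal (if ℓ then M.g x y else M.f x y))

/-- The law of the new latent state under treatment `x` when the previous one was `ℓ`:
the state `true` is absorbing. -/
noncomputable def latentLaw (x : Fin K) (ℓ : Bool) : Measure Bool :=
  bern (if ℓ then 1 else M.p x)

/-- The law of the new pair (latent state, response) under treatment `x` when the previous latent
state was `ℓ`: first the latent state moves, then the response is drawn from the law that
belongs to the new latent state. -/
noncomputable def stepLaw (x : Fin K) (ℓ : Bool) : Measure (Bool × 𝕐) :=
  (M.latentLaw x ℓ).bind (fun ℓ' => (M.respLaw x ℓ').map (Prod.mk ℓ'))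

theorem isProbabilityMeasure_bern {q : ℝ} (hq : q ∈ Set.Icc (0 : ℝ) 1) :
    IsProbabilityMeasure (bern q) := by
  constructor
  simp only [bern, Measure.coe_add, Measure.coe_smul, Pi.add_apply, Pi.smul_apply,
    measure_univ, smul_eq_mul, mul_one]
  rw [← ENNReal.ofReal_add hq.1 (by linarith [hq.2])]
  simp

theorem isProbabilityMeasure_respLaw (x : Fin K) (ℓ : Bool) :
    IsProbabilityMeasure (M.respLaw x ℓ) := by
  constructor
  cases ℓ
  · simp [respLaw, M.lintegral_f]
  · simp [respLaw, M.lintegral_g]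

theorem isProbabilityMeasure_stepLaw (x : Fin K) (ℓ : Bool) :
    IsProbabilityMeasure (M.stepLaw x ℓ) := by
  have h1 : IsProbabilityMeasure (M.latentLaw x ℓ) := by
    apply isProbabilityMeasure_bern
    cases ℓ
    · simpa using M.p_mem x
    · simp
  have h2 : ∀ ℓ', IsProbabilityMeasure ((M.respLaw x ℓ').map (Prod.mk ℓ')) := fun ℓ' => by
    have := M.isProbabilityMeasure_respLaw x ℓ'
    exact Measure.isProbabilityMeasure_map measurable_prodMk_left.aemeasurable
  constructor
  rw [stepLaw, Measure.bind_apply MeasurableSet.univ (measurable_of_countable _).aemeasurable]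
  simp only [measure_univ, lintegral_const, mul_one]

/-- `stepLaw` as a Markov kernel on the finite set of pairs (treatment, latent state). -/
noncomputable def stepKernel : Kernel (Fin K × Bool) (Bool × 𝕐) :=
  Kernel.ofFunOfCountable (fun a => M.stepLaw a.1 a.2)

instance : IsMarkovKernel M.stepKernel :=
  ⟨fun a => M.isProbabilityMeasure_stepLaw a.1 a.2⟩

end Model

section Law

variable {K : ℕ} {𝕐 : Type u} [MeasurableSpace 𝕐]

/-- The pair `(X_{t+1}, L_t)` as a function of the trajectory up to time `t`. -/
def stepInput (X : AssignmentRule K 𝕐) (t : ℕ) (h : (i : Finset.Iic t) → State 𝕐 i) :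
    Fin K × Bool :=
  (X.toFun t (fun i => (h ⟨(i : ℕ) + 1, Finset.mem_Iic.2 i.2⟩).2),
    (h ⟨t, Finset.mem_Iic.2 le_rfl⟩).1)

theorem measurable_stepInput (X : AssignmentRule K 𝕐) (t : ℕ) :
    Measurable (stepInput X t) := by
  refine Measurable.prodMk ((X.measurable_toFun t).comp (measurable_pi_iff.2 fun i => ?_)) ?_
  · exact measurable_snd.comp (measurable_pi_apply
      (⟨(i : ℕ) + 1, Finset.mem_Iic.2 i.2⟩ : Finset.Iic t))
  · exact measurable_fst.comp (measurable_pi_apply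
      (⟨t, Finset.mem_Iic.2 le_rfl⟩ : Finset.Iic t))

/-- The conditional law of `(L_{t+1}, Y_{t+1})` given the past when treatments are assigned
by `X`. -/
noncomputable def transKernel (M : Model K 𝕐) (X : AssignmentRule K 𝕐) (t : ℕ) :
    Kernel ((i : Finset.Iic t) → State 𝕐 i) (State 𝕐 (t + 1)) :=
  M.stepKernel.comap (stepInput X t) (measurable_stepInput X t)

instance (M : Model K 𝕐) (X : AssignmentRule K 𝕐) (t : ℕ) :
    IsMarkovKernel (transKernel M X t) :=
  inferInstanceAs (IsMarkovKernel (M.stepKernel.comap _ (measurable_stepInput X t)))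

/-- The law `P_π` of the trajectory under the assignment rule `X`, when `P(L_0 = 1) = π`. -/
noncomputable def law (M : Model K 𝕐) (π : ℝ) (X : AssignmentRule K 𝕐) : Measure (Traj 𝕐) :=
  Kernel.trajMeasure (X := State 𝕐) ((bern π).map (fun ℓ => ((ℓ, PUnit.unit) : State 𝕐 0)))
    (transKernel M X)

end Law

/-- The infimum of a set of times, with `inf ∅ = ∞`. -/
noncomputable def firstTime (S : ℕ → Prop) : ℕ∞ := ⨅ (t : ℕ) (_ : S t), (t : ℕ∞)

/-- The change-point `Θ`. -/
noncomputable def changePoint {𝕐 : Type u} (ω : Traj 𝕐) : ℕ∞ :=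
  firstTime (fun t => latent t ω = true)

section Problem

variable {K : ℕ} {𝕐 : Type u} [MeasurableSpace 𝕐] (M : Model K 𝕐)

/-- The expected cost `c E_π[T] + P_π(T < Θ)` of the procedure `(T, X)`. -/
noncomputable def cost (c π : ℝ) (T : Traj 𝕐 → ℕ∞) (X : AssignmentRule K 𝕐) : ENNReal :=
  ENNReal.ofReal c * ∫⁻ ω, (T ω : ENNReal) ∂(law M π X) + law M π X {ω | T ω < changePoint ω}

/-- The optimal cost `J_c^*(π)`: the infimum of the expected cost over all assignment rules and
all stopping times of the filtration of the responses. -/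
noncomputable def optCost (c π : ℝ) : ENNReal :=
  ⨅ (X : AssignmentRule K 𝕐) (T : Traj 𝕐 → ℕ∞) (_ : IsStoppingTime (obsFiltration 𝕐) T),
    cost M c π T X

/-- The posterior probability `P_π(L_t = ℓ | F_t)` under the rule `X`. -/
noncomputable def condProb (π : ℝ) (X : AssignmentRule K 𝕐) (ℓ : Bool) (t : ℕ) : Traj 𝕐 → ℝ :=
  (law M π X)[{ω | latent t ω = ℓ}.indicator (fun _ => (1 : ℝ)) | obsFiltration 𝕐 t]

/-- The posterior probability that the change has occurred by time `t`. -/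
noncomputable def posterior (π : ℝ) (X : AssignmentRule K 𝕐) (t : ℕ) (ω : Traj 𝕐) : ℝ :=
  condProb M π X true t ω

/-- The posterior odds, with values in `[0, ∞]`. -/
noncomputable def posteriorOdds (π : ℝ) (X : AssignmentRule K 𝕐) (t : ℕ) (ω : Traj 𝕐) : ENNReal :=
  ENNReal.ofReal (condProb M π X true t ω) / ENNReal.ofReal (condProb M π X false t ω)

/-- The predictive density `φ(y; z, x)` of the next response. -/
noncomputable def predDensity (z : ℝ) (x : Fin K) (y : 𝕐) : ℝ :=
  (z + M.p x * (1 - z)) * M.g x y + (1 - M.p x) * (1 - z) * M.f x y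

/-- The updated posterior probability `ψ(z, x, y)`. -/
noncomputable def update (z : ℝ) (x : Fin K) (y : 𝕐) : ℝ :=
  (z + M.p x * (1 - z)) * M.g x y / predDensity M z x y

/-- The expected future optimal cost `∫ J_c^*(ψ(z, x, y)) φ(y; z, x) μ(dy)`. -/
noncomputable def futureCost (c z : ℝ) (x : Fin K) : ENNReal :=
  ∫⁻ y, optCost M c (update M z x y) * ENNReal.ofReal (predDensity M z x y) ∂M.μ

/-- `X` is a dynamic-programming assignment rule `X_c^*` for the prior `π`: almost surely, every
treatment `X_{t+1}` minimizes the expected future optimal cost given the posterior probability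
at time `t`. Ties may be broken in any way. -/
def IsDPRule (c π : ℝ) (X : AssignmentRule K 𝕐) : Prop :=
  ∀ t : ℕ, ∀ᵐ ω ∂(law M π X), ∀ x : Fin K,
    futureCost M c (posterior M π X t ω) (X.treatment t ω) ≤
      futureCost M c (posterior M π X t ω) x

/-- The dynamic-programming stopping rule `inf {t ≥ 0 : 1 - Γ̂_t ≤ J_c^*(Γ̂_t)}`, where `Γ̂` is the
posterior probability process under `X`. -/
noncomputable def dpStop (c π : ℝ) (X : AssignmentRule K 𝕐) (ω : Traj 𝕐) : ℕ∞ :=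
  firstTime (fun t =>
    ENNReal.ofReal (1 - posterior M π X t ω) ≤ optCost M c (posterior M π X t ω))

end Problem

end ChangePoint

namespace ChangePoint

/-! ### Costs as affine functions of the prior. -/

section Mixture

/-! For a fixed procedure `(T, X)` the prior enters only through the law of the initial state, so
the cost is affine in it: `z * α + (1 - z) * β`, with `α`, `β` the costs under priors `1` and `0`
(`cost_eq_smul_add`). Stopping at `z` is optimal iff `1 - z ≤ z * α + (1 - z) * β` for every
procedure. Divided by `1 - z`, this bounds `1` by `α * z / (1 - z) + β`, which is nondecreasing in
`z` because `α ≥ 0`; hence the stopping region is an up-set of `[0, 1]`, and it contains `1`.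

For the region to contain its infimum `b` it must be closed. Infinite `α` or `β` would spoil
continuity at the endpoints, so only the bounded truncations `min T n` are tested;
`le_cost_of_forall_le_cost_min` shows that they suffice. The stopping rules then agree path by path,
since almost surely the posterior lies in `[0, 1]` at all times and odds increase with probability.
-/

theorem bern_eq_smul_add (π : ℝ) :
    bern π = ENNReal.ofReal π • bern 1 + ENNReal.ofReal (1 - π) • bern 0 := by
  simp [bern]

theorem comp_add_smul {α β : Type*} [MeasurableSpace α] [MeasurableSpace β] (κ : Kernel α β)
    (a b : ENNReal) (μ ν : Measure α) :
    (a • μ + b • ν).bind κ = a • μ.bind κ + b • ν.bind κ := by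
  ext s hs
  simp [Measure.bind_apply hs κ.measurable.aemeasurable]

/-- `trajMeasure` pushes the initial measure forward and then composes it with a kernel; both
operations are linear in that measure. -/
theorem trajMeasure_add_smul {E : ℕ → Type*} [∀ n, MeasurableSpace (E n)]
    (κ : (n : ℕ) → Kernel ((i : Finset.Iic n) → E i) (E (n + 1))) [∀ n, IsMarkovKernel (κ n)]
    (a b : ENNReal) (μ ν : Measure (E 0)) :
    Kernel.trajMeasure (X := E) (a • μ + b • ν) κ =
      a • Kernel.trajMeasure (X := E) μ κ + b • Kernel.trajMeasure (X := E) ν κ := by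
  simp only [Kernel.trajMeasure]
  erw [Measure.map_add _ _ (MeasurableEquiv.measurable _), Measure.map_smul, Measure.map_smul,
    comp_add_smul]
  rfl

variable {K : ℕ} {𝕐 : Type*} [MeasurableSpace 𝕐] (M : Model K 𝕐)

/-- The law of the trajectory is a mixture over the initial latent state. -/
theorem law_eq_smul_add (π : ℝ) (X : AssignmentRule K 𝕐) :
    law M π X = ENNReal.ofReal π • law M 1 X + ENNReal.ofReal (1 - π) • law M 0 X := by
  have h : Measurable (fun ℓ => ((ℓ, PUnit.unit) : State 𝕐 0)) := measurable_of_countable _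
  simp only [law]
  rw [bern_eq_smul_add π, Measure.map_add _ _ h, Measure.map_smul, Measure.map_smul,
    trajMeasure_add_smul]

theorem cost_eq_smul_add (c π : ℝ) (T : Traj 𝕐 → ℕ∞) (X : AssignmentRule K 𝕐) :
    cost M c π T X =
      ENNReal.ofReal π * cost M c 1 T X + ENNReal.ofReal (1 - π) * cost M c 0 T X := by
  simp only [cost]
  rw [law_eq_smul_add M π X]
  simp only [lintegral_add_measure, lintegral_smul_measure, Measure.add_apply,
    Measure.smul_apply, smul_eq_mul]
  ring

theorem isProbabilityMeasure_law {π : ℝ} (hπ : π ∈ Set.Icc (0 : ℝ) 1) (X : AssignmentRule K 𝕐) :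
    IsProbabilityMeasure (law M π X) := by
  have := Model.isProbabilityMeasure_bern hπ
  have : IsProbabilityMeasure ((bern π).map (fun ℓ => ((ℓ, PUnit.unit) : State 𝕐 0))) :=
    Measure.isProbabilityMeasure_map (measurable_of_countable _).aemeasurable
  rw [law]
  infer_instance

end Mixture

/-! ### Reduction to bounded stopping times. -/

section Truncation

variable {K : ℕ} {𝕐 : Type*} [MeasurableSpace 𝕐] (M : Model K 𝕐)

theorem cost_min_ne_top (c : ℝ) {π : ℝ} (hπ : π ∈ Set.Icc (0 : ℝ) 1) (T : Traj 𝕐 → ℕ∞)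
    (X : AssignmentRule K 𝕐) (n : ℕ) : cost M c π (fun ω => min (T ω) n) X ≠ ⊤ := by
  have := isProbabilityMeasure_law M hπ X
  refine ENNReal.add_ne_top.2 ⟨ENNReal.mul_ne_top ENNReal.ofReal_ne_top ?_, measure_ne_top _ _⟩
  refine ne_top_of_le_ne_top (ENNReal.natCast_ne_top n) ?_
  calc ∫⁻ ω, ((min (T ω) n : ℕ∞) : ENNReal) ∂(law M π X)
      ≤ ∫⁻ _, (n : ENNReal) ∂(law M π X) :=
        lintegral_mono fun ω => by
          simp
    _ = n := by simp

/-- Truncation shortens sampling and can create new false alarms only where `T > n`. -/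
theorem cost_min_le (c π : ℝ) (T : Traj 𝕐 → ℕ∞) (X : AssignmentRule K 𝕐) (n : ℕ) :
    cost M c π (fun ω => min (T ω) n) X ≤
      cost M c π T X + law M π X {ω | (n : ℕ∞) < T ω} := by
  simp only [cost, add_assoc]
  gcongr
  · exact min_le_left _ _
  · refine (measure_mono ?_).trans (measure_union_le _ _)
    intro ω hω
    by_cases h : (n : ℕ∞) < T ω
    · exact Or.inr h
    · left
      rwa [Set.mem_ofPred_eq, min_eq_left (not_lt.1 h)] at hω

/-- A lower bound for the costs of all truncations of a stopping time is one for its own cost. -/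
theorem le_cost_of_forall_le_cost_min {c : ℝ} (hc : 0 < c) {π : ℝ} {T : Traj 𝕐 → ℕ∞}
    (hT : IsStoppingTime (obsFiltration 𝕐) T) (X : AssignmentRule K 𝕐) {a : ENNReal}
    (h : ∀ n : ℕ, a ≤ cost M c π (fun ω => min (T ω) n) X) : a ≤ cost M c π T X := by
  by_cases hI : ∫⁻ ω, (T ω : ENNReal) ∂(law M π X) = ⊤
  · simp [cost, hI, ENNReal.mul_top, hc]
  -- Markov's inequality. The case `n = 0` is separate because `0 / 0 = 0` in `ENNReal`.
  have hbound (n : ℕ) : law M π X {ω | (n : ℕ∞) < T ω} ≤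
      (∫⁻ ω, (T ω : ENNReal) ∂(law M π X)) / n := by
    have hm : MeasurableSet {ω | (n : ℕ∞) < T ω} :=
      (obsFiltration 𝕐).le n _ (hT.measurableSet_gt n)
    rcases Nat.eq_zero_or_pos n with rfl | hn
    · by_cases h0 : ∫⁻ ω, (T ω : ENNReal) ∂(law M π X) = 0
      · have hle : law M π X {ω | ((0 : ℕ) : ℕ∞) < T ω} ≤
            ∫⁻ ω, (T ω : ENNReal) ∂(law M π X) := by
          rw [← lintegral_indicator_one hm]
          refine lintegral_mono fun ω => Set.indicator_apply_le' (fun hω => ?_) (by simp)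
          have : (1 : ℕ∞) ≤ T ω := Order.one_le_iff_pos.2 (by simpa using hω)
          simpa using ENat.toENNReal_le.2 this
        simpa [h0] using hle
      · simp [ENNReal.div_zero h0]
    rw [ENNReal.le_div_iff_mul_le (by simp [hn.ne']) (by simp), mul_comm,
      ← lintegral_indicator_const hm]
    refine lintegral_mono fun ω => Set.indicator_apply_le' (fun hω => ?_) (by simp)
    simpa using ENat.toENNReal_le.2 (le_of_lt hω)
  have hlim : Tendsto
      (fun n : ℕ => cost M c π T X + (∫⁻ ω, (T ω : ENNReal) ∂(law M π X)) / n) atTop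
      (nhds (cost M c π T X + 0)) := by
    refine Tendsto.const_add _ ?_
    simpa [div_eq_mul_inv] using
      ENNReal.Tendsto.const_mul ENNReal.tendsto_inv_nat_nhds_zero (Or.inr hI)
  rw [add_zero] at hlim
  exact ge_of_tendsto' hlim fun n => (h n).trans
    ((cost_min_le M c π T X n).trans (by gcongr; exact hbound n))

theorem le_optCost_iff {c : ℝ} (hc : 0 < c) (π : ℝ) (a : ENNReal) :
    a ≤ optCost M c π ↔ ∀ (X : AssignmentRule K 𝕐) (T : Traj 𝕐 → ℕ∞)
      (_ : IsStoppingTime (obsFiltration 𝕐) T) (n : ℕ),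
        a ≤ cost M c π (fun ω => min (T ω) n) X := by
  simp only [optCost, le_iInf_iff]
  exact ⟨fun h X T hT n => h X _ (hT.min_const n),
    fun h X T hT => le_cost_of_forall_le_cost_min M hc hT X (h X T hT)⟩

end Truncation

/-! ### The stopping region is a closed up-set of the unit interval. -/

section StoppingRegion

variable {K : ℕ} {𝕐 : Type*} [MeasurableSpace 𝕐] (M : Model K 𝕐)

/-- The posterior probabilities at which it is optimal to stop. -/
def stoppingRegion (c : ℝ) : Set ℝ :=
  {z ∈ Set.Icc (0 : ℝ) 1 | ENNReal.ofReal (1 - z) ≤ optCost M c z}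

/-- Truncated costs are finite, so the constraint becomes a real affine inequality, continuous in
`z`. -/
theorem ofReal_le_cost_min_iff (c : ℝ) (T : Traj 𝕐 → ℕ∞) (X : AssignmentRule K 𝕐) (n : ℕ)
    {z : ℝ} (hz : z ∈ Set.Icc (0 : ℝ) 1) :
    ENNReal.ofReal (1 - z) ≤ cost M c z (fun ω => min (T ω) n) X ↔
      1 - z ≤ z * (cost M c 1 (fun ω => min (T ω) n) X).toReal +
        (1 - z) * (cost M c 0 (fun ω => min (T ω) n) X).toReal := by
  have h1 := cost_min_ne_top M c (π := 1) (by simp) T X n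
  have h0 := cost_min_ne_top M c (π := 0) (by simp) T X n
  have hz1 : 0 ≤ 1 - z := by linarith [hz.2]
  have hnn : 0 ≤ z * (cost M c 1 (fun ω => min (T ω) n) X).toReal +
      (1 - z) * (cost M c 0 (fun ω => min (T ω) n) X).toReal :=
    add_nonneg (mul_nonneg hz.1 ENNReal.toReal_nonneg) (mul_nonneg hz1 ENNReal.toReal_nonneg)
  rw [cost_eq_smul_add, ← ENNReal.ofReal_le_ofReal_iff hnn,
    ENNReal.ofReal_add (mul_nonneg hz.1 ENNReal.toReal_nonneg)
      (mul_nonneg hz1 ENNReal.toReal_nonneg),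
    ENNReal.ofReal_mul hz.1, ENNReal.ofReal_mul hz1, ENNReal.ofReal_toReal h1,
    ENNReal.ofReal_toReal h0]

theorem mem_stoppingRegion_iff {c : ℝ} (hc : 0 < c) (z : ℝ) :
    z ∈ stoppingRegion M c ↔ z ∈ Set.Icc (0 : ℝ) 1 ∧
      ∀ (X : AssignmentRule K 𝕐) (T : Traj 𝕐 → ℕ∞)
        (_ : IsStoppingTime (obsFiltration 𝕐) T) (n : ℕ),
          1 - z ≤ z * (cost M c 1 (fun ω => min (T ω) n) X).toReal +
            (1 - z) * (cost M c 0 (fun ω => min (T ω) n) X).toReal := by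
  refine and_congr_right fun hz => ?_
  simp only [le_optCost_iff M hc, ofReal_le_cost_min_iff M c _ _ _ hz]

theorem isClosed_stoppingRegion {c : ℝ} (hc : 0 < c) : IsClosed (stoppingRegion M c) := by
  have h : stoppingRegion M c = {z | _} := Set.ext (mem_stoppingRegion_iff M hc)
  rw [h]
  simp only [Set.ofPred_and, Set.ofPred_forall]
  refine isClosed_Icc.inter (isClosed_iInter fun X => isClosed_iInter fun T =>
    isClosed_iInter fun _ => isClosed_iInter fun n => isClosed_le ?_ ?_) <;> fun_prop

theorem one_mem_stoppingRegion (c : ℝ) : (1 : ℝ) ∈ stoppingRegion M c := by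
  simp [stoppingRegion]

theorem mem_stoppingRegion_of_le {c : ℝ} (hc : 0 < c) {z w : ℝ} (hz : z ∈ stoppingRegion M c)
    (hzw : z ≤ w) (hw : w ≤ 1) : w ∈ stoppingRegion M c := by
  rw [mem_stoppingRegion_iff M hc] at hz ⊢
  refine ⟨⟨hz.1.1.trans hzw, hw⟩, fun X T hT n => ?_⟩
  have h := hz.2 X T hT n
  have hz0 := hz.1.1
  set α := (cost M c 1 (fun ω => min (T ω) n) X).toReal
  set β := (cost M c 0 (fun ω => min (T ω) n) X).toReal
  have hα : 0 ≤ α := ENNReal.toReal_nonneg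
  rcases hw.eq_or_lt with rfl | hw1
  · simpa using hα
  have hz1 : 0 < 1 - z := by linarith
  -- The constraint at `z` times `1 - w` gives this up to the slack `(w - z) * α ≥ 0`.
  have key : (1 - w) * (1 - z) ≤ (w * α + (1 - w) * β) * (1 - z) := by
    nlinarith [mul_le_mul_of_nonneg_left h (sub_nonneg.2 hw),
      mul_nonneg (sub_nonneg.2 hzw) hα]
  exact le_of_mul_le_mul_right key hz1

/-- The stopping region is an interval `[b, 1]`. -/
theorem exists_stoppingRegion_eq_Icc {c : ℝ} (hc : 0 < c) :
    ∃ b ∈ Set.Icc (0 : ℝ) 1, stoppingRegion M c = Set.Icc b 1 := by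
  have hbdd : BddBelow (stoppingRegion M c) := ⟨0, fun z hz => hz.1.1⟩
  have hmem := (isClosed_stoppingRegion M hc).csInf_mem ⟨1, one_mem_stoppingRegion M c⟩ hbdd
  refine ⟨_, hmem.1, Set.ext fun z => ⟨fun hz => ⟨csInf_le hbdd hz, hz.1.2⟩, fun hz => ?_⟩⟩
  exact mem_stoppingRegion_of_le M hc hmem hz.1 hz.2

end StoppingRegion

/-! ### Posterior probability and odds. -/

section Posterior

variable {K : ℕ} {𝕐 : Type*} [MeasurableSpace 𝕐] (M : Model K 𝕐)

theorem measurableSet_latent_eq (t : ℕ) (ℓ : Bool) :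
    MeasurableSet {ω : Traj 𝕐 | latent t ω = ℓ} :=
  (measurable_fst.comp (measurable_pi_apply t)) (measurableSet_singleton ℓ)

theorem condProb_nonneg (π : ℝ) (X : AssignmentRule K 𝕐) (ℓ : Bool) (t : ℕ) :
    ∀ᵐ ω ∂(law M π X), 0 ≤ condProb M π X ℓ t ω :=
  condExp_nonneg (ae_of_all _ fun _ => Set.indicator_nonneg (by simp) _)

theorem condProb_true_add_false {π : ℝ} (hπ : π ∈ Set.Icc (0 : ℝ) 1) (X : AssignmentRule K 𝕐)
    (t : ℕ) : ∀ᵐ ω ∂(law M π X),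
      condProb M π X true t ω + condProb M π X false t ω = 1 := by
  have := isProbabilityMeasure_law M hπ X
  have hint (ℓ : Bool) : Integrable ({ω | latent t ω = ℓ}.indicator (fun _ => (1 : ℝ)))
      (law M π X) := (integrable_const 1).indicator (measurableSet_latent_eq t ℓ)
  have h := condExp_add (hint true) (hint false) (obsFiltration 𝕐 t)
  have hsum : {ω : Traj 𝕐 | latent t ω = true}.indicator (fun _ => (1 : ℝ)) +
      {ω | latent t ω = false}.indicator (fun _ => (1 : ℝ)) = fun _ => 1 := by
    ext ω
    cases hω : latent t ω <;> simp [hω]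
  rw [hsum, condExp_const ((obsFiltration 𝕐).le t)] at h
  filter_upwards [h] with ω hω
  exact hω.symm

/-- The odds map is strictly increasing; at `1` it takes the value `1 / 0 = ⊤`, attained nowhere
else. -/
theorem ofReal_div_le_ofReal_div_iff {b z : ℝ} (hb : b ∈ Set.Icc (0 : ℝ) 1)
    (hz : z ∈ Set.Icc (0 : ℝ) 1) :
    ENNReal.ofReal b / ENNReal.ofReal (1 - b) ≤ ENNReal.ofReal z / ENNReal.ofReal (1 - z) ↔
      b ≤ z := by
  rcases hz.2.eq_or_lt with rfl | hz1
  · simp [hb.2]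
  have hz1' : 0 < 1 - z := by linarith
  rcases hb.2.eq_or_lt with rfl | hb1
  · have hne : ENNReal.ofReal z / ENNReal.ofReal (1 - z) ≠ ⊤ :=
      ENNReal.div_ne_top ENNReal.ofReal_ne_top (by simpa using hz1)
    simp [hne, hz1]
  have hb1' : 0 < 1 - b := by linarith
  rw [← ENNReal.ofReal_div_of_pos hz1', ← ENNReal.ofReal_div_of_pos hb1',
    ENNReal.ofReal_le_ofReal_iff (div_nonneg hz.1 hz1'.le), div_le_div_iff₀ hb1' hz1']
  constructor <;> intro h <;> nlinarith

end Posterior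

end ChangePoint

theorem theorem1 {K : ℕ} {𝕐 : Type*} [MeasurableSpace 𝕐] (M : ChangePoint.Model K 𝕐)
    (c : ℝ) (hc : 0 < c) :
    ∃ b ∈ Set.Icc (0 : ℝ) 1,
      ∀ π ∈ Set.Icc (0 : ℝ) 1, ∀ X : ChangePoint.AssignmentRule K 𝕐,
        ChangePoint.IsDPRule M c π X →
        ∀ᵐ ω ∂(ChangePoint.law M π X),
          ChangePoint.dpStop M c π X ω =
              ChangePoint.firstTime (fun t => b ≤ ChangePoint.posterior M π X t ω) ∧
          ChangePoint.dpStop M c π X ω =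
              ChangePoint.firstTime (fun t =>
                ENNReal.ofReal b / ENNReal.ofReal (1 - b) ≤
                  ChangePoint.posteriorOdds M π X t ω) := by
  obtain ⟨b, hb, hS⟩ := ChangePoint.exists_stoppingRegion_eq_Icc M hc
  refine ⟨b, hb, fun π hπ X _ => ?_⟩
  -- Conditional expectations are fixed only up to null sets; countably many times leave one null
  -- set, off which everything is pathwise.
  filter_upwards [ae_all_iff.2 fun t => ChangePoint.condProb_true_add_false M hπ X t,
    ae_all_iff.2 fun t => ChangePoint.condProb_nonneg M π X true t,
    ae_all_iff.2 fun t => ChangePoint.condProb_nonneg M π X false t] with ω hadd htrue hfalse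
  have hmem (t : ℕ) : ChangePoint.posterior M π X t ω ∈ Set.Icc (0 : ℝ) 1 :=
    ⟨htrue t, by rw [ChangePoint.posterior]; linarith [hadd t, hfalse t]⟩
  have hregion (t : ℕ) : ENNReal.ofReal (1 - ChangePoint.posterior M π X t ω) ≤
      ChangePoint.optCost M c (ChangePoint.posterior M π X t ω) ↔
        b ≤ ChangePoint.posterior M π X t ω := by
    have h := Set.ext_iff.1 hS (ChangePoint.posterior M π X t ω)
    exact ⟨fun hle => (h.1 ⟨hmem t, hle⟩).1, fun hle => (h.2 ⟨hle, (hmem t).2⟩).2⟩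
  have hodds (t : ℕ) : ENNReal.ofReal b / ENNReal.ofReal (1 - b) ≤
      ChangePoint.posteriorOdds M π X t ω ↔ b ≤ ChangePoint.posterior M π X t ω := by
    rw [ChangePoint.posteriorOdds, eq_sub_of_add_eq' (hadd t)]
    exact ChangePoint.ofReal_div_le_ofReal_div_iff hb (hmem t)
  simp only [ChangePoint.dpStop, hregion, hodds, and_self]
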